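/- A quasi-affine algebraic manifold (smooth irreducible quasi-affine variety) $X$ over $\mathbb{C}$ is called flexible if for every $x \in X$ the tangent space $T_xX$ is spanned by the tangent vectors at $x$ to the orbits of one-parameter unipotent subgroups of $\mathrm{Aut}(X)$, i.e. of algebraic actions of the additive group $(\mathbb{C},+)$ on $X$. For an integer $k>0$, a flexible quasi-affine manifold $X$ is called $k$-flexible if there are a morphism $\rho : X \to Q$ into a normal affine algebraic variety $Q$ and a Zariski open dense subset $Q_0 \subset Q$ such that $\rho^{-1}(Q_0)$ is isomorphic to $Q_0 \times \mathbb{C}^k$ over $Q_0$. Proposition. For every $n \ge 2$, the variety $SL(n)$ of complex $n \times n$ matrices of determinant $1$ is $k$-flexible with $k = n^2-n$. -/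

import Mathlib

open CategoryTheory AlgebraicGeometry

noncomputable section

namespace KFlex

/-- The base scheme `Spec ℂ`. A complex scheme is a scheme `X` with a structure morphism
`π : X ⟶ SpecC`. -/
abbrev SpecC : Scheme.{0} := Spec (CommRingCat.of ℂ)

/-- Given a morphism `act : 𝔸¹ × X ⟶ X`, a `T`-valued point `x` of `X` and a `T`-valued point `t`
of `𝔸¹` (that is, a global function on `T`), the `T`-valued point `act (t, x)` of `X`. -/
def flow {X : Scheme.{0}} (act : 𝔸(PUnit.{1}; X) ⟶ X) {T : Scheme.{0}} (t : Γ(T, ⊤))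
    (x : T ⟶ X) : T ⟶ X :=
  AffineSpace.homOfVector x (fun _ => t) ≫ act

/-- An algebraic action over `ℂ` of the additive group `𝔾ₐ = (ℂ, +)` on a complex scheme `X`: a
morphism `𝔸¹ × X ⟶ X` over `ℂ` that satisfies the laws of a group action (stated on `T`-valued
points, for all schemes `T`). Its image in `Aut X` is a one-parameter unipotent subgroup. -/
structure GaAction {X : Scheme.{0}} (π : X ⟶ SpecC) where
  /-- the action morphism -/
  act : 𝔸(PUnit.{1}; X) ⟶ X
  act_over : act ≫ π = (𝔸(PUnit.{1}; X) ↘ X) ≫ π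
  zero_flow : ∀ (T : Scheme.{0}) (x : T ⟶ X), flow act 0 x = x
  add_flow : ∀ (T : Scheme.{0}) (s t : Γ(T, ⊤)) (x : T ⟶ X),
    flow act (s + t) x = flow act s (flow act t x)

/-- A `ℂ`-point of a complex scheme. -/
structure CPoint {X : Scheme.{0}} (π : X ⟶ SpecC) where
  /-- the underlying morphism -/
  hom : SpecC ⟶ X
  hom_over : hom ≫ π = 𝟙 SpecC

/-- Evaluation of global regular functions at a `ℂ`-point. -/
def CPoint.eval {X : Scheme.{0}} {π : X ⟶ SpecC} (p : CPoint π) : Γ(X, ⊤) →+* ℂ :=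
  (p.hom.appTop ≫ (Scheme.ΓSpecIso (CommRingCat.of ℂ)).hom).hom

/-- The Zariski tangent space of a quasi-affine complex scheme `X` at a `ℂ`-point `p`: the complex
vector space of `ℂ`-linear derivations at `p` of the ring of regular functions. As `X` is open in
`Spec Γ(X, ⊤)`, the local ring at `p` is a localization of `Γ(X, ⊤)`, so that these are the same
as the point derivations of the local ring. -/
def tangentSpace {X : Scheme.{0}} [X.IsQuasiAffine] {π : X ⟶ SpecC} (p : CPoint π) :
    Submodule ℂ (Γ(X, ⊤) → ℂ) where
  carrier := {D | (∀ f g, D (f + g) = D f + D g) ∧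
    (∀ f g, D (f * g) = p.eval f * D g + p.eval g * D f) ∧
    (∀ c, D (π.appTop c) = 0)}
  add_mem' := by
    rintro D E ⟨hD, hD', hD''⟩ ⟨hE, hE', hE''⟩
    refine ⟨fun f g => ?_, fun f g => ?_, fun c => ?_⟩
    · simp only [Pi.add_apply, hD, hE]; ring
    · simp only [Pi.add_apply, hD', hE']; ring
    · simp only [Pi.add_apply, hD'', hE'', add_zero]
  zero_mem' := ⟨by simp, by simp, by simp⟩
  smul_mem' := by
    rintro a D ⟨hD, hD', hD''⟩
    refine ⟨fun f g => ?_, fun f g => ?_, fun c => ?_⟩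
    · simp only [Pi.smul_apply, smul_eq_mul, hD]; ring
    · simp only [Pi.smul_apply, smul_eq_mul, hD']; ring
    · simp only [Pi.smul_apply, smul_eq_mul, hD'', mul_zero]

/-- The orbit map `t ↦ t • p`, as a morphism from the affine line `Spec ℂ[t]` to `X`. -/
def GaAction.orbitMap {X : Scheme.{0}} {π : X ⟶ SpecC} (σ : GaAction π) (p : CPoint π) :
    Spec (CommRingCat.of (Polynomial ℂ)) ⟶ X :=
  flow σ.act ((Scheme.ΓSpecIso (CommRingCat.of (Polynomial ℂ))).inv.hom Polynomial.X)
    (Spec.map (CommRingCat.ofHom (Polynomial.C : ℂ →+* Polynomial ℂ)) ≫ p.hom)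

/-- The tangent vector at `p` to the orbit of `p`: it sends a regular function `f` to the derivative
of `t ↦ f (t • p)` at `t = 0`. -/
def GaAction.velocity {X : Scheme.{0}} {π : X ⟶ SpecC} (σ : GaAction π) (p : CPoint π) :
    Γ(X, ⊤) → ℂ := fun f =>
  (Polynomial.derivative
    (((σ.orbitMap p).appTop ≫
      (Scheme.ΓSpecIso (CommRingCat.of (Polynomial ℂ))).hom).hom f : Polynomial ℂ)).eval 0

/-- A quasi-affine complex scheme is flexible if its tangent space at every (closed) point is
spanned by the tangent vectors to the orbits of one-parameter unipotent groups of
automorphisms. -/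
def IsFlexible {X : Scheme.{0}} [X.IsQuasiAffine] (π : X ⟶ SpecC) : Prop :=
  ∀ p : CPoint π, Submodule.span ℂ (Set.range fun σ : GaAction π => σ.velocity p) = tangentSpace p

/-- A quasi-affine algebraic manifold: a smooth irreducible quasi-affine complex variety. (It is of
finite type and separated because it is smooth and quasi-affine.) -/
structure IsQuasiAffineManifold {X : Scheme.{0}} (π : X ⟶ SpecC) : Prop where
  quasiAffine : X.IsQuasiAffine
  integral : IsIntegral X
  smooth : Smooth π

/-- A normal affine algebraic variety over `ℂ`. -/
structure IsNormalAffineVariety {Q : Scheme.{0}} (q : Q ⟶ SpecC) : Prop where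
  affine : IsAffine Q
  integral : IsIntegral Q
  finiteType : LocallyOfFiniteType q
  normal : ∀ x : Q, IsIntegrallyClosed (Q.presheaf.stalk x)

/-- Over the open set `Q₀` of `Q`, the morphism `ρ : X ⟶ Q` is the trivial bundle with fibre `ℂᵏ`:
`ρ⁻¹(Q₀)` is isomorphic to `Q₀ × ℂᵏ` over `Q₀`. -/
def IsTrivialOver {X Q : Scheme.{0}} (k : ℕ) (ρ : X ⟶ Q) (Q₀ : Q.Opens) : Prop :=
  ∃ e : (ρ ⁻¹ᵁ Q₀).toScheme ≅ 𝔸(Fin k; Q₀.toScheme),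
    e.hom ≫ (𝔸(Fin k; Q₀.toScheme) ↘ Q₀.toScheme) = ρ ∣_ Q₀

/-- A flexible quasi-affine manifold `X` is `k`-flexible, `k > 0`, if there is a morphism
`ρ : X ⟶ Q` over `ℂ` into a normal affine variety such that over a dense open `Q₀` of `Q` it is the
trivial bundle `Q₀ × ℂᵏ`. -/
structure IsKFlexible {X : Scheme.{0}} (k : ℕ) (π : X ⟶ SpecC) : Prop where
  pos : 0 < k
  manifold : IsQuasiAffineManifold π
  flexible : haveI := manifold.quasiAffine; IsFlexible π
  exists_fibration : ∃ (Q : Scheme.{0}) (q : Q ⟶ SpecC) (ρ : X ⟶ Q) (Q₀ : Q.Opens),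
    IsNormalAffineVariety q ∧ ρ ≫ q = π ∧ Dense (Q₀ : Set Q) ∧ IsTrivialOver k ρ Q₀

/-- The coordinate ring `ℂ[x_{ij}] / (det (x_{ij}) - 1)` of `SL(n)`. -/
abbrev SLRing (n : ℕ) : Type :=
  MvPolynomial (Fin n × Fin n) ℂ ⧸
    Ideal.span {(Matrix.mvPolynomialX (Fin n) (Fin n) ℂ).det - 1}

/-- The affine variety `SL(n)` over `ℂ`. -/
abbrev SL (n : ℕ) : Scheme.{0} := Spec (CommRingCat.of (SLRing n))

/-- The structure morphism of `SL(n)`. -/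
abbrev SL.structureMap (n : ℕ) : SL n ⟶ SpecC :=
  Spec.map (CommRingCat.ofHom (algebraMap ℂ (SLRing n)))

end KFlex

end

/-! The fibration sends a matrix to its leading principal minors of sizes 1, …, n - 1. Each minor is
affine in its last diagonal entry, with the preceding minor as slope (`leadingMinor_succ_sub`).
Hence, where these minors are invertible, the diagonal entries can be solved for one after another,
the last one from det = 1. The n² - n off-diagonal entries stay free, so the map is a trivial bundle
over the torus in affine (n - 1)-space (`isTrivialOver_minorMap`).

For flexibility, tangent vectors at A are the matrices W A with tr W = 0, as det (1 + εW) = 1 + ε tr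
W. Trace-zero matrices are spanned by matrices N with N² = 0 (`mem_span_sq_zero_of_trace_eq_zero`),
and N A is the velocity of the action A ↦ (1 + tN) A.

Integrality holds because det - 1 is irreducible, smoothness because matrices of determinant 1 lift
along square-zero extensions. Morphisms into `SL n` are handled as matrices of determinant 1 over
Γ(T, ⊤). -/

noncomputable section

namespace KFlex

open Matrix

/-! ### Solving for the diagonal from the leading minors -/

section LeadingMinors

variable {R : Type*} [CommRing R] {n : ℕ}

/-- The leading principal minor of size `k`. -/
def leadingMinor (M : Matrix (Fin n) (Fin n) R) (k : ℕ) (hk : k ≤ n) : R :=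
  (M.submatrix (Fin.castLE hk) (Fin.castLE hk)).det

lemma leadingMinor_zero (M : Matrix (Fin n) (Fin n) R) :
    leadingMinor M 0 (Nat.zero_le n) = 1 := by
  simp [leadingMinor]

lemma leadingMinor_self (M : Matrix (Fin n) (Fin n) R) : leadingMinor M n le_rfl = M.det := rfl

lemma map_leadingMinor {S : Type*} [CommRing S] (f : R →+* S) (M : Matrix (Fin n) (Fin n) R)
    (k : ℕ) (hk : k ≤ n) : f (leadingMinor M k hk) = leadingMinor (M.map f) k hk := by
  simp only [leadingMinor, RingHom.map_det]
  rfl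

lemma leadingMinor_congr {M N : Matrix (Fin n) (Fin n) R} {k : ℕ} (hk : k ≤ n)
    (h : ∀ i j : Fin n, (i : ℕ) < k → (j : ℕ) < k → M i j = N i j) :
    leadingMinor M k hk = leadingMinor N k hk := by
  unfold leadingMinor
  congr 1
  ext i j
  exact h _ _ i.2 j.2

/-- The leading minor of size `k + 1` is an affine function of its last diagonal entry, with the
leading minor of size `k` as coefficient. -/
lemma leadingMinor_succ_sub {M N : Matrix (Fin n) (Fin n) R} {k : ℕ} (hk : k + 1 ≤ n)
    (h : ∀ i j : Fin n, (i : ℕ) ≤ k → (j : ℕ) ≤ k → ((i : ℕ) ≠ k ∨ (j : ℕ) ≠ k) → M i j = N i j) :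
    leadingMinor M (k + 1) hk - leadingMinor N (k + 1) hk =
      (M ⟨k, hk⟩ ⟨k, hk⟩ - N ⟨k, hk⟩ ⟨k, hk⟩) * leadingMinor M k (Nat.le_of_succ_le hk) := by
  unfold leadingMinor
  -- In the expansions along the last row only the last terms differ: no cofactor of that row
  -- involves the corner entry.
  rw [det_succ_row _ (Fin.last k), det_succ_row (N.submatrix _ _) (Fin.last k),
    Fin.sum_univ_castSucc, Fin.sum_univ_castSucc]
  have hsub : ∀ j, ((M.submatrix (Fin.castLE hk) (Fin.castLE hk)).submatrix
      (Fin.last k).succAbove (Fin.succAbove j)) =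
      ((N.submatrix (Fin.castLE hk) (Fin.castLE hk)).submatrix
      (Fin.last k).succAbove (Fin.succAbove j)) := by
    intro j
    ext a b
    apply h
    · exact Nat.lt_succ_iff.mp ((Fin.last k).succAbove a).2
    · exact Nat.lt_succ_iff.mp (j.succAbove b).2
    · left; simpa using a.2.ne
  have hsum : ∀ j : Fin k, (M.submatrix (Fin.castLE hk) (Fin.castLE hk)) (Fin.last k) j.castSucc =
      (N.submatrix (Fin.castLE hk) (Fin.castLE hk)) (Fin.last k) j.castSucc := by
    intro j
    apply h
    · simp
    · simp
    · right; simpa using j.2.ne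
  simp_rw [← hsub, ← hsum]
  have hlast : ((M.submatrix (Fin.castLE hk) (Fin.castLE hk)).submatrix
      (Fin.last k).succAbove (Fin.last k).succAbove) =
      M.submatrix (Fin.castLE (Nat.le_of_succ_le hk)) (Fin.castLE (Nat.le_of_succ_le hk)) := by
    ext a b
    simp
  rw [hlast, add_sub_add_left_eq_sub, ← two_mul, Even.neg_one_pow (even_two_mul _)]
  have e : (Fin.castLE hk (Fin.last k)) = ⟨k, hk⟩ := rfl
  simp only [submatrix_apply, e]
  ring

/-- A matrix is determined by its off-diagonal entries and its leading minors, if these are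
units. -/
lemma eq_of_leadingMinor_eq {M N : Matrix (Fin n) (Fin n) R}
    (hoff : ∀ i j, i ≠ j → M i j = N i j)
    (hminor : ∀ k (hk : k + 1 ≤ n), leadingMinor M (k + 1) hk = leadingMinor N (k + 1) hk)
    (hunit : ∀ k (hk : k + 1 < n), IsUnit (leadingMinor M (k + 1) hk.le)) : M = N := by
  have hdiag : ∀ k (hk : k < n), M ⟨k, hk⟩ ⟨k, hk⟩ = N ⟨k, hk⟩ ⟨k, hk⟩ := by
    intro k
    induction k using Nat.strong_induction_on with
    | _ k ih =>
      intro hk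
      have key := leadingMinor_succ_sub (M := M) (N := N) (k := k) hk (by
        intro i j hi hj hij
        by_cases e : i = j
        · subst e
          exact ih i (by omega) i.2
        · exact hoff i j e)
      rw [hminor k hk, sub_self] at key
      have hu : IsUnit (leadingMinor M k hk.le) := by
        cases k with
        | zero => rw [leadingMinor_zero]; exact isUnit_one
        | succ k => exact hunit k hk
      exact sub_eq_zero.mp (hu.mul_left_eq_zero.mp key.symm)
  ext i j
  by_cases e : i = j
  · subst e; exact hdiag i i.2
  · exact hoff i j e

/-- There is a matrix with prescribed off-diagonal entries and leading minors, if these are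
units. -/
lemma exists_leadingMinor_eq (M : Matrix (Fin n) (Fin n) R) (u : ℕ → R)
    (hu : ∀ k, k + 1 < n → IsUnit (u k)) :
    ∃ N : Matrix (Fin n) (Fin n) R, (∀ i j, i ≠ j → N i j = M i j) ∧
      ∀ k (hk : k + 1 ≤ n), leadingMinor N (k + 1) hk = u k := by
  suffices H : ∀ m, m ≤ n → ∃ N : Matrix (Fin n) (Fin n) R, (∀ i j, i ≠ j → N i j = M i j) ∧
      ∀ k (hk : k + 1 ≤ n), k < m → leadingMinor N (k + 1) hk = u k by
    obtain ⟨N, h₁, h₂⟩ := H n le_rfl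
    exact ⟨N, h₁, fun k hk => h₂ k hk hk⟩
  intro m
  induction m with
  | zero => exact fun _ => ⟨M, fun _ _ _ => rfl, by simp⟩
  | succ m ih =>
    intro hm
    obtain ⟨N, h₁, h₂⟩ := ih (Nat.le_of_succ_le hm)
    have hunit : IsUnit (leadingMinor N m (Nat.le_of_succ_le hm)) := by
      cases m with
      | zero => rw [leadingMinor_zero]; exact isUnit_one
      | succ m => rw [h₂ m _ (Nat.lt_succ_self m)]; exact hu m hm
    obtain ⟨v, hv⟩ := hunit
    -- Adding `c` to the corner entry changes the minor of size `m + 1` by `c * v`, where `v` is the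
    -- minor of size `m`.
    let c : R := (u m - leadingMinor N (m + 1) hm) * ↑v⁻¹
    let N' := N + Matrix.single ⟨m, hm⟩ ⟨m, hm⟩ c
    have hN' : ∀ i j : Fin n, ((i : ℕ) ≠ m ∨ (j : ℕ) ≠ m) → N' i j = N i j := by
      intro i j hij
      simp only [N', Matrix.add_apply, add_eq_left]
      apply Matrix.single_apply_of_ne
      simp only [Fin.ext_iff]
      omega
    refine ⟨N', fun i j hij => ?_, fun k hk hkm => ?_⟩
    · rw [hN' i j, h₁ i j hij]
      rw [ne_eq, Fin.ext_iff] at hij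
      omega
    · rcases Nat.lt_succ_iff_lt_or_eq.mp hkm with hkm | rfl
      · rw [← h₂ k hk hkm]
        exact leadingMinor_congr hk fun i j hi hj => hN' i j (by omega)
      · have key := leadingMinor_succ_sub (M := N') (N := N) hk fun i j _ _ => hN' i j
        have hmk : leadingMinor N' k (Nat.le_of_succ_le hk) = v := by
          rw [hv]
          exact leadingMinor_congr _ fun i j hi hj => hN' i j (by omega)
        rw [hmk] at key
        have : N' ⟨k, hk⟩ ⟨k, hk⟩ - N ⟨k, hk⟩ ⟨k, hk⟩ = c := by simp [N']
        rw [this, Units.inv_mul_cancel_right] at key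
        linear_combination key

end LeadingMinors

/-! ### Irreducibility of det - 1 -/

section Domain

open MvPolynomial

/-- Factors of a nonzero polynomial involve no further variables. -/
lemma vars_subset_of_dvd {σ R : Type*} [CommRing R] [IsDomain R] {p q : MvPolynomial σ R}
    (hq : q ≠ 0) (h : p ∣ q) : p.vars ⊆ q.vars := by
  classical
  obtain ⟨r, rfl⟩ := h
  intro i hi
  have hp : p ≠ 0 := left_ne_zero_of_mul hq
  have hr : r ≠ 0 := right_ne_zero_of_mul hq
  rw [vars_def, Multiset.mem_toFinset, ← Multiset.count_pos, ← degreeOf_def] at hi ⊢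
  rw [degreeOf_mul_eq hp hr]
  omega

lemma det_mem_supported {σ ι R : Type*} [CommRing R] [Fintype ι] [DecidableEq ι]
    (M : Matrix ι ι (MvPolynomial σ R)) (s : Set σ) (h : ∀ i j, M i j ∈ supported R s) :
    M.det ∈ supported R s := by
  rw [det_apply]
  refine sum_mem fun τ _ => ?_
  rw [Units.smul_def]
  exact zsmul_mem (prod_mem fun i _ => h _ _) _

/-- Expansion along the first row makes det - 1 linear in x₀₀, with coefficient `M` and constant
term `N - 1`, so it suffices that these have no common factor. A divisor of `M` involves no
first-row variable; setting that row to zero fixes the divisor and turns `N - 1` into -1. -/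
lemma irreducible_det_sub_one (m : ℕ) :
    Irreducible ((mvPolynomialX (Fin (m + 1)) (Fin (m + 1)) ℂ).det - 1) := by
  set A := mvPolynomialX (Fin (m + 1)) (Fin (m + 1)) ℂ with hA
  set M := (A.submatrix Fin.succ Fin.succ).det with hM
  set N := ∑ j : Fin m, (-1) ^ (j.succ : ℕ) * A 0 j.succ *
    (A.submatrix Fin.succ (Fin.succAbove j.succ)).det with hN
  have hdet : A.det - 1 = M * X (0, 0) + (N - 1) := by
    rw [det_succ_row_zero, Fin.sum_univ_succ]
    have e : A.submatrix Fin.succ (Fin.succAbove 0) = A.submatrix Fin.succ Fin.succ := by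
      rw [Fin.succAbove_zero]
    rw [e]
    simp only [hN, hM, Fin.val_zero, pow_zero, one_mul]
    simp only [hA, mvPolynomialX_apply]
    ring
  have hM_supp : M ∈ supported ℂ {p : Fin (m + 1) × Fin (m + 1) | p.1 ≠ 0} :=
    det_mem_supported _ _ fun i j => X_mem_supported.mpr (Fin.succ_ne_zero i)
  have hM0 : M ≠ 0 := by
    intro h0
    -- At the identity matrix the minor `M` takes the value 1.
    have h1 : (MvPolynomial.eval fun p : Fin (m + 1) × Fin (m + 1) =>
        (1 : Matrix (Fin (m + 1)) (Fin (m + 1)) ℂ) p.1 p.2) M = 1 := by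
      rw [hM, RingHom.map_det]
      convert det_one (R := ℂ) (n := Fin m)
      ext i j
      simp [hA, Matrix.one_apply]
    rw [h0, map_zero] at h1
    exact zero_ne_one h1
  rw [hdet]
  apply irreducible_mul_X_add _ _ _ hM0
  · intro hi
    exact mem_supported.mp hM_supp hi rfl
  · intro hi
    have : N - 1 ∈ supported ℂ {p : Fin (m + 1) × Fin (m + 1) | p ≠ (0, 0)} := by
      refine sub_mem (sum_mem fun j _ => mul_mem (mul_mem ?_ ?_) ?_) (one_mem _)
      · exact pow_mem (neg_mem (one_mem _)) _
      · exact X_mem_supported.mpr (by simp)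
      · exact det_mem_supported _ _ fun i j => X_mem_supported.mpr (by simp)
    exact mem_supported.mp this hi rfl
  · intro d hdM hdN
    let ψ : MvPolynomial (Fin (m + 1) × Fin (m + 1)) ℂ →ₐ[ℂ]
        MvPolynomial (Fin (m + 1) × Fin (m + 1)) ℂ :=
      aeval fun p => if p.1 = 0 then 0 else X p
    have hψd : ψ d = d := by
      conv_rhs => rw [← aeval_X_left_apply d]
      refine eval₂Hom_congr' rfl (fun i hi _ => ?_) rfl
      have : i.1 ≠ 0 := mem_supported.mp hM_supp (vars_subset_of_dvd hM0 hdM hi)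
      simp [this]
    have hψN : ψ (N - 1) = -1 := by
      simp [hN, hA, ψ]
    have : d ∣ -1 := by
      rw [← hψd, ← hψN]
      exact map_dvd ψ hdN
    exact isUnit_of_dvd_unit this isUnit_one.neg

lemma isDomain_slRing {n : ℕ} (hn : 0 < n) : IsDomain (SLRing n) := by
  obtain ⟨m, rfl⟩ := Nat.exists_eq_succ_of_ne_zero hn.ne'
  have hirr := irreducible_det_sub_one m
  exact (Ideal.Quotient.isDomain_iff_prime _).mpr
    ((Ideal.span_singleton_prime hirr.ne_zero).mpr hirr.prime)

end Domain

/-! ### Smoothness by infinitesimal lifting -/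

section Smooth

/-- The generic matrix of determinant `1`. -/
def genericMatrix (n : ℕ) : Matrix (Fin n) (Fin n) (SLRing n) :=
  (mvPolynomialX (Fin n) (Fin n) ℂ).map (Ideal.Quotient.mk _)

lemma det_genericMatrix (n : ℕ) : (genericMatrix n).det = 1 := by
  rw [genericMatrix, ← RingHom.mapMatrix_apply, ← RingHom.map_det, ← sub_eq_zero,
    ← map_one (Ideal.Quotient.mk _), ← map_sub, Ideal.Quotient.eq_zero_iff_mem]
  exact Ideal.mem_span_singleton_self _

/-- The ring homomorphism out of `SLRing n` given by a matrix of determinant `1`. -/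
def slRingLift {n : ℕ} {S : Type*} [CommRing S] (f : ℂ →+* S) (M : Matrix (Fin n) (Fin n) S)
    (hM : M.det = 1) : SLRing n →+* S :=
  Ideal.Quotient.lift _ (MvPolynomial.eval₂Hom f fun p => M p.1 p.2) (by
    intro a ha
    obtain ⟨b, rfl⟩ := Ideal.mem_span_singleton'.mp ha
    rw [map_mul, map_sub, map_one, RingHom.map_det, RingHom.mapMatrix_apply,
      MvPolynomial.coe_eval₂Hom, mvPolynomialX_map_eval₂, hM, sub_self, mul_zero])

lemma slRingLift_genericMatrix {n : ℕ} {S : Type*} [CommRing S] (f : ℂ →+* S)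
    (M : Matrix (Fin n) (Fin n) S) (hM : M.det = 1) (i j : Fin n) :
    slRingLift f M hM (genericMatrix n i j) = M i j := by
  simp [slRingLift, genericMatrix]

lemma slRingLift_algebraMap {n : ℕ} {S : Type*} [CommRing S] (f : ℂ →+* S)
    (M : Matrix (Fin n) (Fin n) S) (hM : M.det = 1) (c : ℂ) :
    slRingLift f M hM (algebraMap ℂ (SLRing n) c) = f c :=
  (Ideal.Quotient.lift_mk _ _ _).trans (MvPolynomial.eval₂_C _ _ _)

lemma slRing_hom_ext {n : ℕ} {S : Type*} [CommRing S] {f g : SLRing n →+* S}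
    (hc : ∀ c : ℂ, f (algebraMap ℂ (SLRing n) c) = g (algebraMap ℂ (SLRing n) c))
    (hX : ∀ i j, f (genericMatrix n i j) = g (genericMatrix n i j)) : f = g := by
  apply Ideal.Quotient.ringHom_ext
  apply MvPolynomial.ringHom_ext
  · exact hc
  · rintro ⟨i, j⟩
    exact hX i j

/-- Along a surjection with square-zero kernel, matrices of determinant `1` lift. -/
lemma exists_lift_det_eq_one {n : ℕ} (hn : 0 < n) {B : Type*} [CommRing B] (I : Ideal B)
    (hI : I ^ 2 = ⊥) (M : Matrix (Fin n) (Fin n) (B ⧸ I)) (hM : M.det = 1) :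
    ∃ N : Matrix (Fin n) (Fin n) B, N.det = 1 ∧ N.map (Ideal.Quotient.mk I) = M := by
  choose s hs using Ideal.Quotient.mk_surjective (I := I)
  let L : Matrix (Fin n) (Fin n) B := M.map s
  have hL : L.map (Ideal.Quotient.mk I) = M := by
    ext i j
    simp [L, hs]
  have hdet : Ideal.Quotient.mk I L.det = 1 := by
    rw [RingHom.map_det, RingHom.mapMatrix_apply, hL, hM]
  have hmem : L.det - 1 ∈ I := by
    rw [← Ideal.Quotient.eq_zero_iff_mem, map_sub, hdet, map_one, sub_self]
  have hsq : (L.det - 1) * (L.det - 1) = 0 := by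
    have := Ideal.mul_mem_mul hmem hmem
    rwa [← pow_two, hI, Ideal.mem_bot] at this
  let i₀ : Fin n := ⟨0, hn⟩
  -- If det L = 1 + δ with δ² = 0, then 2 - det L = 1 - δ is its inverse, and it is 1 modulo `I`.
  refine ⟨L.updateRow i₀ ((2 - L.det) • L i₀), ?_, ?_⟩
  · rw [det_updateRow_smul, updateRow_eq_self]
    linear_combination -hsq
  · ext i j
    by_cases h : i = i₀
    · subst h
      simp only [map_apply, updateRow_self, Pi.smul_apply, smul_eq_mul, map_mul, map_sub, hdet]
      have := congr_fun₂ hL i₀ j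
      simp only [map_apply] at this
      rw [this, map_ofNat]
      ring
    · rw [map_apply, updateRow_ne h, ← hL, map_apply]

lemma formallySmooth_slRing {n : ℕ} (hn : 0 < n) : Algebra.FormallySmooth ℂ (SLRing n) := by
  apply Algebra.FormallySmooth.of_comp_surjective
  intro B _ _ I hI f
  obtain ⟨N, hN, hNf⟩ := exists_lift_det_eq_one hn I hI ((genericMatrix n).map f) (by
    have := (f : SLRing n →+* B ⧸ I).map_det (genericMatrix n)
    rw [det_genericMatrix, map_one] at this
    exact this.symm)
  let g : SLRing n →ₐ[ℂ] B :=
    { slRingLift (algebraMap ℂ B) N hN with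
      commutes' := slRingLift_algebraMap _ _ _ }
  refine ⟨g, ?_⟩
  have : ((Ideal.Quotient.mkₐ ℂ I).comp g : SLRing n →+* B ⧸ I) = f := by
    apply slRing_hom_ext
    · intro c
      exact ((((Ideal.Quotient.mkₐ ℂ I).comp g).commutes c).trans (f.commutes c).symm)
    · intro i j
      have h := congr_fun₂ hNf i j
      simp only [map_apply] at h
      refine Eq.trans ?_ h
      exact congrArg (Ideal.Quotient.mk I) (slRingLift_genericMatrix _ _ hN _ _)
  exact AlgHom.coe_ringHom_injective this

lemma smooth_slRing {n : ℕ} (hn : 0 < n) : Algebra.Smooth ℂ (SLRing n) where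
  formallySmooth := formallySmooth_slRing hn
  finitePresentation :=
    .quotient ((Submodule.fg_span_singleton _))

end Smooth

/-! ### Trace-zero matrices and square-zero matrices -/

section SquareZero

/-- The complex matrices of trace zero are spanned by the integer matrices of square zero. -/
lemma mem_span_sq_zero_of_trace_eq_zero {n : ℕ} (W : Matrix (Fin n) (Fin n) ℂ)
    (hW : W.trace = 0) :
    W ∈ Submodule.span ℂ
      {V | ∃ N : Matrix (Fin n) (Fin n) ℤ, N * N = 0 ∧ V = N.map (Int.cast : ℤ → ℂ)} := by
  set S := Submodule.span ℂ
    {V | ∃ N : Matrix (Fin n) (Fin n) ℤ, N * N = 0 ∧ V = N.map (Int.cast : ℤ → ℂ)} with hS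
  have hmem : ∀ N : Matrix (Fin n) (Fin n) ℤ, N * N = 0 → N.map (Int.cast : ℤ → ℂ) ∈ S :=
    fun N hN => Submodule.subset_span ⟨N, hN, rfl⟩
  have hmap : ∀ i j : Fin n, (single i j (1 : ℤ)).map (Int.cast : ℤ → ℂ) = single i j 1 := by
    intro i j
    ext a b
    simp [single_apply]
  have hoff : ∀ i j : Fin n, i ≠ j → single i j (1 : ℂ) ∈ S := by
    intro i j hij
    rw [← hmap]
    apply hmem
    rw [single_mul_single_of_ne _ _ _ _ hij.symm]
  have hdiag : ∀ i j : Fin n, single i i (1 : ℂ) - single j j 1 ∈ S := by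
    intro i j
    by_cases hij : i = j
    · subst hij; simp
    -- The block with rows (1, -1) and (1, -1) squares to zero and has diagonal (1, -1).
    have h := hmem (single i i 1 - single i j 1 + single j i 1 - single j j 1) (by
      simp only [sub_mul, add_mul, mul_sub, mul_add, single_mul_single_same,
        single_mul_single_of_ne _ _ _ _ hij, single_mul_single_of_ne _ _ _ _ (Ne.symm hij)]
      simp only [mul_one]
      abel)
    have e : single i i (1 : ℂ) - single j j 1 =
        (single i i (1 : ℤ) - single i j 1 + single j i 1 - single j j 1).map
          (Int.cast : ℤ → ℂ) + single i j 1 - single j i 1 := by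
      ext a b
      simp only [single_apply, Matrix.sub_apply, Matrix.add_apply, map_apply, Int.cast_sub, Int.cast_add,
        Int.cast_ite, Int.cast_one, Int.cast_zero]
      ring
    rw [e]
    exact sub_mem (add_mem h (hoff i j hij)) (hoff j i (Ne.symm hij))
  rcases Nat.eq_zero_or_pos n with rfl | hn
  · rw [Subsingleton.elim W 0]
    exact zero_mem _
  let o : Fin n := ⟨0, hn⟩
  -- The subtracted terms add up to tr W times one diagonal unit, which is zero.
  have hW' : W = ∑ i, ∑ j, W i j • (single i j (1 : ℂ) - if i = j then single o o 1 else 0) := by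
    have h1 : ∑ i, ∑ j, W i j • (if i = j then single o o (1 : ℂ) else 0) = 0 := by
      simp only [smul_ite, smul_zero, Finset.sum_ite_eq, Finset.mem_univ, if_true]
      rw [← Finset.sum_smul]
      exact (congrArg (· • single o o (1 : ℂ)) hW).trans (zero_smul _ _)
    simp only [smul_sub, Finset.sum_sub_distrib, h1, sub_zero]
    conv_lhs => rw [matrix_eq_sum_single W]
    simp
  rw [hW']
  refine sum_mem fun i _ => sum_mem fun j _ => Submodule.smul_mem _ _ ?_
  by_cases hij : i = j
  · subst hij; simpa using hdiag i o
  · simpa [hij] using hoff i j hij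

/-- A first-order deformation of `A` within the matrices of determinant `1` has the form
`(1 + ε W) A` with `W` of trace zero. -/
lemma trace_eq_zero_of_det_dualNumber {n : ℕ} (W : Matrix (Fin n) (Fin n) ℂ)
    (h : (1 + (DualNumber.eps : DualNumber ℂ) • W.map (algebraMap ℂ (DualNumber ℂ))).det = 1) :
    W.trace = 0 := by
  -- Since ε² = 0, the determinant is 1 + ε tr W.
  rw [det_one_add_smul, pow_two, DualNumber.eps_mul_eps, mul_zero, add_zero, add_eq_left] at h
  have h2 : (W.map (algebraMap ℂ (DualNumber ℂ))).trace = algebraMap ℂ (DualNumber ℂ) W.trace := by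
    simp [trace]
  rw [h2] at h
  have := congrArg TrivSqZeroExt.snd h
  simpa [TrivSqZeroExt.algebraMap_eq_inl] using this

end SquareZero

/-! ### Points of affine schemes, of `SL n` and of affine space -/

section Points

variable {T T' : Scheme.{0}} {R S : Type} [CommRing R] [CommRing S]

/-- The ring homomorphism `R → Γ(T, ⊤)` of a `T`-valued point of `Spec R`. -/
def pull (x : T ⟶ Spec (CommRingCat.of R)) : R →+* Γ(T, ⊤) :=
  ((Scheme.ΓSpecIso (CommRingCat.of R)).inv ≫ x.appTop).hom

/-- The `T`-valued point of `Spec R` given by a ring homomorphism `R → Γ(T, ⊤)`. -/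
def toSpec (φ : R →+* Γ(T, ⊤)) : T ⟶ Spec (CommRingCat.of R) :=
  T.toSpecΓ ≫ Spec.map (CommRingCat.ofHom φ)

lemma pull_toSpec (φ : R →+* Γ(T, ⊤)) : pull (toSpec φ) = φ := by
  simp [pull, toSpec]

lemma pull_injective : Function.Injective (pull : (T ⟶ Spec (CommRingCat.of R)) → _) :=
  fun _ _ h => ext_to_Spec (CommRingCat.hom_ext h)

lemma pull_comp (f : T' ⟶ T) (x : T ⟶ Spec (CommRingCat.of R)) :
    pull (f ≫ x) = f.appTop.hom.comp (pull x) := by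
  rw [pull, Scheme.Hom.comp_appTop]
  rfl

lemma pull_comp_specMap (φ : R →+* S) (x : T ⟶ Spec (CommRingCat.of S)) :
    pull (x ≫ Spec.map (CommRingCat.ofHom φ)) = (pull x).comp φ := by
  have := Scheme.ΓSpecIso_inv_naturality (CommRingCat.ofHom φ)
  simp only [pull, Scheme.Hom.comp_appTop]
  rw [← reassoc_of% this]
  rfl

end Points

section SLPoints

variable {T T' : Scheme.{0}} {n : ℕ}

/-- The matrix of a `T`-valued point of `SL n`. -/
def mat (x : T ⟶ SL n) : Matrix (Fin n) (Fin n) Γ(T, ⊤) := (genericMatrix n).map (pull x)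

lemma det_mat (x : T ⟶ SL n) : (mat x).det = 1 := by
  rw [mat, ← RingHom.mapMatrix_apply, ← RingHom.map_det, det_genericMatrix, map_one]

/-- The `T`-valued point of `SL n` given by a matrix of determinant `1`. -/
def ofMat (s : T ⟶ SpecC) (M : Matrix (Fin n) (Fin n) Γ(T, ⊤)) (hM : M.det = 1) : T ⟶ SL n :=
  toSpec (slRingLift (pull s) M hM)

lemma mat_ofMat (s : T ⟶ SpecC) (M : Matrix (Fin n) (Fin n) Γ(T, ⊤)) (hM : M.det = 1) :
    mat (ofMat s M hM) = M := by
  ext i j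
  rw [mat, map_apply, ofMat, pull_toSpec, slRingLift_genericMatrix]

lemma pull_structureMap (x : T ⟶ SL n) :
    pull (x ≫ SL.structureMap n) = (pull x).comp (algebraMap ℂ (SLRing n)) :=
  pull_comp_specMap _ _

lemma ofMat_over (s : T ⟶ SpecC) (M : Matrix (Fin n) (Fin n) Γ(T, ⊤)) (hM : M.det = 1) :
    ofMat s M hM ≫ SL.structureMap n = s := by
  apply pull_injective
  ext c
  rw [pull_structureMap, ofMat, pull_toSpec, RingHom.comp_apply, slRingLift_algebraMap]

lemma hom_ext_mat {x y : T ⟶ SL n} (h : x ≫ SL.structureMap n = y ≫ SL.structureMap n)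
    (hm : mat x = mat y) : x = y := by
  apply pull_injective
  apply slRing_hom_ext
  · intro c
    have := congrArg pull h
    rw [pull_structureMap, pull_structureMap] at this
    exact RingHom.congr_fun this c
  · intro i j
    exact congr_fun₂ hm i j

lemma mat_comp (f : T' ⟶ T) (x : T ⟶ SL n) : mat (f ≫ x) = (mat x).map f.appTop := by
  ext i j
  simp [mat, pull_comp]

end SLPoints

section SpecMvPolynomial

variable {T T' : Scheme.{0}} {ι : Type}

/-- The structure morphism of the affine space `Spec ℂ[ι]`. -/
abbrev mvStructureMap (ι : Type) : Spec (CommRingCat.of (MvPolynomial ι ℂ)) ⟶ SpecC :=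
  Spec.map (CommRingCat.ofHom (algebraMap ℂ (MvPolynomial ι ℂ)))

lemma hom_ext_mvPolynomial {x y : T ⟶ Spec (CommRingCat.of (MvPolynomial ι ℂ))}
    (h : x ≫ mvStructureMap ι = y ≫ mvStructureMap ι)
    (hX : ∀ i, pull x (MvPolynomial.X i) = pull y (MvPolynomial.X i)) : x = y := by
  apply pull_injective
  apply MvPolynomial.ringHom_ext
  · intro c
    have := congrArg pull h
    rw [pull_comp_specMap, pull_comp_specMap] at this
    exact RingHom.congr_fun this c
  · exact hX

/-- Normality: the stalks are localizations of a polynomial ring over ℂ, which is integrally closed.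
-/
lemma isNormalAffineVariety_mvPolynomial [Finite ι] :
    IsNormalAffineVariety (mvStructureMap ι) where
  affine := inferInstance
  integral := inferInstance
  finiteType := by
    rw [HasRingHomProperty.Spec_iff (P := @LocallyOfFiniteType)]
    exact RingHom.finiteType_algebraMap.mpr inferInstance
  normal := by
    intro x
    let _ : Algebra (MvPolynomial ι ℂ)
        ((Spec (CommRingCat.of (MvPolynomial ι ℂ))).presheaf.stalk x) :=
      StructureSheaf.stalkAlgebra (MvPolynomial ι ℂ) x
    have : x.asIdeal.IsPrime := x.isPrime
    have : IsLocalization.AtPrime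
        ((Spec (CommRingCat.of (MvPolynomial ι ℂ))).presheaf.stalk x) x.asIdeal :=
      StructureSheaf.IsLocalization.to_stalk (MvPolynomial ι ℂ) x
    exact isIntegrallyClosed_of_isLocalization _ x.asIdeal.primeCompl
      x.asIdeal.primeCompl_le_nonZeroDivisors

end SpecMvPolynomial

section Manifold

lemma isQuasiAffineManifold_SL {n : ℕ} (hn : 0 < n) :
    IsQuasiAffineManifold (SL.structureMap n) where
  quasiAffine := inferInstance
  integral := by
    have := isDomain_slRing hn
    infer_instance
  smooth := by
    rw [HasRingHomProperty.Spec_iff (P := @Smooth)]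
    exact RingHom.smooth_algebraMap.mpr (smooth_slRing hn)

end Manifold

/-! ### The fibration by leading minors -/

section Fibration

variable {T : Scheme.{0}}

lemma isUnit_appTop_ι_basicOpen {X : Scheme.{0}} (f : Γ(X, ⊤)) :
    IsUnit ((X.basicOpen f).ι.appTop f) := by
  have h : (X.basicOpen f).ι.appTop f = (X.basicOpen f).topIso.inv
      (X.presheaf.map (homOfLE (X.basicOpen_le f)).op f) := by
    rw [Scheme.Opens.ι_appTop, Scheme.Opens.topIso_inv]
    exact congrArg (fun φ => CommRingCat.Hom.hom φ f) (X.presheaf.map_comp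
      (homOfLE (X.basicOpen_le f)).op (eqToHom (X.basicOpen f).ι_image_top).op)
  rw [h]
  exact (RingedSpace.isUnit_res_basicOpen X.toRingedSpace f).map
    (X.basicOpen f).topIso.inv.hom

variable (m : ℕ)

/-- The affine space whose coordinates are the leading minors of sizes `1, …, m`. -/
abbrev minorSpace : Scheme.{0} := Spec (CommRingCat.of (MvPolynomial (Fin m) ℂ))

/-- The leading minors of sizes `1, …, m` on `SL (m + 1)`. -/
def minorMap : SL (m + 1) ⟶ minorSpace m :=
  Spec.map (CommRingCat.ofHom (MvPolynomial.aeval fun i : Fin m =>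
    leadingMinor (genericMatrix (m + 1)) (i + 1) (by omega) :
      MvPolynomial (Fin m) ℂ →ₐ[ℂ] SLRing (m + 1)).toRingHom)

lemma minorMap_over : minorMap m ≫ mvStructureMap (Fin m) = SL.structureMap (m + 1) := by
  rw [minorMap, ← Spec.map_comp, ← CommRingCat.ofHom_comp]
  congr 2
  exact AlgHom.comp_algebraMap (MvPolynomial.aeval fun i : Fin m =>
    leadingMinor (genericMatrix (m + 1)) (i + 1) (by omega) :
      MvPolynomial (Fin m) ℂ →ₐ[ℂ] SLRing (m + 1))

variable {m} in
lemma pull_minorMap (x : T ⟶ SL (m + 1)) (i : Fin m) :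
    pull (x ≫ minorMap m) (MvPolynomial.X i) = leadingMinor (mat x) (i + 1) (by omega) := by
  rw [minorMap, pull_comp_specMap, mat, ← map_leadingMinor]
  simp

/-- The open subset of `minorSpace m` on which no coordinate vanishes. -/
def minorTorus : (minorSpace m).Opens :=
  (minorSpace m).basicOpen
    (pull (𝟙 (minorSpace m)) (∏ i : Fin m, (MvPolynomial.X i : MvPolynomial (Fin m) ℂ)))

/-- Affine space is irreducible, and the product of the coordinates is a nonzero polynomial, so its
basic open set is nonempty. -/
lemma dense_minorTorus : Dense (minorTorus m : Set (minorSpace m)) := by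
  apply (minorTorus m).isOpen.dense
  rw [Set.nonempty_iff_ne_empty]
  intro h
  have h0 : minorTorus m = ⊥ := TopologicalSpace.Opens.ext h
  rw [minorTorus, basicOpen_eq_bot_iff] at h0
  have hinj : Function.Injective (pull (𝟙 (minorSpace m))) := by
    have : pull (𝟙 (minorSpace m)) =
        (Scheme.ΓSpecIso (CommRingCat.of (MvPolynomial (Fin m) ℂ))).inv.hom := by
      simp [pull]
    rw [this]
    exact (ConcreteCategory.bijective_of_isIso
      (Scheme.ΓSpecIso (CommRingCat.of (MvPolynomial (Fin m) ℂ))).inv).1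
  rw [map_eq_zero_iff _ hinj, Finset.prod_eq_zero_iff] at h0
  obtain ⟨i, -, hi⟩ := h0
  exact MvPolynomial.X_ne_zero i hi

variable {m} in
lemma isUnit_pull_minorTorus (y : T ⟶ (minorTorus m).toScheme) (i : Fin m) :
    IsUnit (pull (y ≫ (minorTorus m).ι) (MvPolynomial.X i)) := by
  have h1 : IsUnit (pull (minorTorus m).ι
      (∏ i : Fin m, (MvPolynomial.X i : MvPolynomial (Fin m) ℂ))) := by
    have h := isUnit_appTop_ι_basicOpen (pull (𝟙 (minorSpace m))
      (∏ i : Fin m, (MvPolynomial.X i : MvPolynomial (Fin m) ℂ)))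
    have e := RingHom.congr_fun (pull_comp (minorTorus m).ι (𝟙 (minorSpace m)))
      (∏ i : Fin m, (MvPolynomial.X i : MvPolynomial (Fin m) ℂ))
    rw [Category.comp_id] at e
    rw [e]
    exact h
  rw [pull_comp]
  have h2 : IsUnit (pull (minorTorus m).ι (MvPolynomial.X i)) :=
    isUnit_of_dvd_unit (map_dvd _ (Finset.dvd_prod_of_mem _ (Finset.mem_univ i))) h1
  exact h2.map y.appTop.hom

/-- Where the leading minors do not vanish, they are together with the off-diagonal entries
coordinates on `SL (m + 1)`. -/
lemma isTrivialOver_minorMap :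
    IsTrivialOver ((m + 1) ^ 2 - (m + 1)) (minorMap m) (minorTorus m) := by
  have hcard : Fintype.card {p : Fin (m + 1) × Fin (m + 1) // p.1 ≠ p.2} =
      (m + 1) ^ 2 - (m + 1) := by
    rw [Fintype.card_subtype]
    have := Finset.offDiag_card (Finset.univ : Finset (Fin (m + 1)))
    rw [Finset.card_univ, Fintype.card_fin, ← pow_two] at this
    rw [← this]
    congr 1
    ext p
    simp
  -- The fibre coordinates are indexed by the off-diagonal positions.
  let e : Fin ((m + 1) ^ 2 - (m + 1)) ≃ {p : Fin (m + 1) × Fin (m + 1) // p.1 ≠ p.2} :=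
    (Fintype.equivFinOfCardEq hcard).symm
  set k := (m + 1) ^ 2 - (m + 1)
  let ρ := minorMap m
  let Q₀ := minorTorus m
  let P := 𝔸(Fin k; Q₀.toScheme)
  let pr : P ⟶ Q₀.toScheme := 𝔸(Fin k; Q₀.toScheme) ↘ Q₀.toScheme
  let ι := (ρ ⁻¹ᵁ Q₀).ι
  let f : (ρ ⁻¹ᵁ Q₀).toScheme ⟶ P :=
    AffineSpace.homOfVector (ρ ∣_ Q₀) fun l => mat ι (e l).1.1 (e l).1.2
  have hf_pr : f ≫ pr = ρ ∣_ Q₀ := AffineSpace.homOfVector_over _ _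
  have hf_coord : ∀ l, f.appTop (AffineSpace.coord _ l) = mat ι (e l).1.1 (e l).1.2 :=
    AffineSpace.homOfVector_appTop_coord _ _
  have hrest : ρ ∣_ Q₀ ≫ Q₀.ι = ι ≫ ρ := morphismRestrict_ι ρ Q₀
  -- Index `i` prescribes the minor of size `i + 1`: a base coordinate for `i < m`, and 1 at `i =
  -- m`, where the minor is the determinant.
  let u : ℕ → Γ(P, ⊤) := fun i =>
    if h : i < m then pull (pr ≫ Q₀.ι) (MvPolynomial.X ⟨i, h⟩) else 1
  obtain ⟨N, hNoff, hNminor⟩ := exists_leadingMinor_eq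
    (Matrix.of fun i j => if h : i ≠ j then
      AffineSpace.coord Q₀.toScheme (e.symm ⟨(i, j), h⟩) else (0 : Γ(P, ⊤))) u (by
    intro i hi
    have hi' : i < m := by omega
    simp only [u, hi', dif_pos]
    exact isUnit_pull_minorTorus pr _)
  have hNdet : N.det = 1 := by
    have := hNminor m le_rfl
    rwa [leadingMinor_self, show u m = 1 by simp [u]] at this
  let g₀ : P ⟶ SL (m + 1) := ofMat ((pr ≫ Q₀.ι) ≫ mvStructureMap (Fin m)) N hNdet
  have hg₀ : mat g₀ = N := mat_ofMat _ _ _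
  have hg₀_over : g₀ ≫ SL.structureMap (m + 1) = (pr ≫ Q₀.ι) ≫ mvStructureMap (Fin m) :=
    ofMat_over _ _ _
  have hg₀ρ : pr ≫ Q₀.ι = g₀ ≫ ρ := by
    apply hom_ext_mvPolynomial
    · rw [Category.assoc g₀, minorMap_over, hg₀_over]
    · intro i
      rw [pull_minorMap, hg₀, hNminor]
      simp [u]
  have hpb := isPullback_morphismRestrict ρ Q₀
  -- The preimage of `Q₀` is a fibre product, so `g₀` factors through it once its minors are known
  -- to be the base coordinates.
  let g : P ⟶ (ρ ⁻¹ᵁ Q₀).toScheme := hpb.lift pr g₀ hg₀ρ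
  have hg_pr : g ≫ ρ ∣_ Q₀ = pr := hpb.lift_fst _ _ _
  have hg_ι : g ≫ ι = g₀ := hpb.lift_snd _ _ _
  refine ⟨⟨f, g, ?_, ?_⟩, hf_pr⟩
  · apply hpb.hom_ext
    · rw [Category.assoc, hg_pr, hf_pr, Category.id_comp]
    · rw [Category.assoc, Category.id_comp]
      refine Eq.trans (congrArg (f ≫ ·) hg_ι) ?_
      have hfy : f ≫ pr ≫ Q₀.ι = ι ≫ ρ := by rw [← Category.assoc, hf_pr, hrest]
      apply hom_ext_mat
      · rw [Category.assoc, hg₀_over, ← minorMap_over, ← Category.assoc f, hfy, Category.assoc]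
      · have hminor : ∀ i (hi : i < m), leadingMinor (mat ι) (i + 1) (by omega) =
            pull (f ≫ pr ≫ Q₀.ι) (MvPolynomial.X ⟨i, hi⟩) := by
          intro i hi
          rw [hfy, pull_minorMap]
        symm
        -- Both matrices have the same off-diagonal entries and minors, so uniqueness of the
        -- solution gives `f ≫ g = 𝟙`.
        apply eq_of_leadingMinor_eq
        · intro i j hij
          rw [mat_comp, map_apply, hg₀, hNoff i j hij]
          simp only [of_apply, ne_eq, hij, not_false_eq_true, dif_pos]
          rw [hf_coord, Equiv.apply_symm_apply]
        · intro i hi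
          rcases Nat.lt_or_eq_of_le (Nat.le_of_succ_le_succ hi) with hi' | rfl
          · rw [hminor i hi', mat_comp, hg₀]
            refine Eq.trans ?_ (map_leadingMinor f.appTop.hom _ _ _)
            rw [hNminor, pull_comp]
            simp only [u, hi', dif_pos]
            rfl
          · rw [leadingMinor_self, leadingMinor_self, det_mat, det_mat]
        · intro i hi
          rw [hminor i (by omega), ← Category.assoc]
          exact isUnit_pull_minorTorus _ _
  · apply AffineSpace.hom_ext
    · rw [Category.assoc, Category.id_comp]
      exact (congrArg (g ≫ ·) hf_pr).trans hg_pr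
    · intro l
      have h1 : mat g₀ (e l).1.1 (e l).1.2 = g.appTop (mat ι (e l).1.1 (e l).1.2) := by
        rw [← hg_ι, mat_comp, map_apply]
      rw [Scheme.Hom.comp_appTop, CommRingCat.comp_apply, hf_coord, ← h1, hg₀,
        hNoff _ _ (e l).2]
      simp [(e l).2, Q₀]

end Fibration

/-! ### Flows and their velocities -/

section Flow

variable {X T T' : Scheme.{0}}

lemma comp_flow (act : 𝔸(PUnit.{1}; X) ⟶ X) (t : Γ(T, ⊤)) (x : T ⟶ X) (f : T' ⟶ T) :
    f ≫ flow act t x = flow act (f.appTop t) (f ≫ x) := by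
  rw [flow, flow, ← Category.assoc, AffineSpace.comp_homOfVector]
  rfl

lemma GaAction.flow_over {π : X ⟶ SpecC} (σ : GaAction π) (t : Γ(T, ⊤)) (x : T ⟶ X) :
    flow σ.act t x ≫ π = x ≫ π := by
  rw [flow, Category.assoc, σ.act_over, ← Category.assoc, AffineSpace.homOfVector_over]

end Flow

section Velocity

variable {X : Scheme.{0}} {π : X ⟶ SpecC} (σ : GaAction π) (p : CPoint π)

/-- The pull-back of regular functions along the orbit map. -/
def GaAction.orbitPull : Γ(X, ⊤) →+* Polynomial ℂ :=
  ((σ.orbitMap p).appTop ≫ (Scheme.ΓSpecIso (CommRingCat.of (Polynomial ℂ))).hom).hom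

lemma GaAction.velocity_apply (f : Γ(X, ⊤)) :
    σ.velocity p f = (Polynomial.derivative (σ.orbitPull p f)).eval 0 := rfl

/-- The orbit map restricted to t = 0 is `p`, by `zero_flow`. -/
lemma GaAction.eval_zero_orbitPull (f : Γ(X, ⊤)) : (σ.orbitPull p f).eval 0 = p.eval f := by
  let ev : Polynomial ℂ →+* ℂ := Polynomial.evalRingHom 0
  have h0 : Spec.map (CommRingCat.ofHom ev) ≫ σ.orbitMap p = p.hom := by
    rw [GaAction.orbitMap, comp_flow]
    have h1 : (Spec.map (CommRingCat.ofHom ev)).appTop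
        ((Scheme.ΓSpecIso (CommRingCat.of (Polynomial ℂ))).inv.hom Polynomial.X) = 0 := by
      have := ConcreteCategory.congr_hom
        (Scheme.ΓSpecIso_inv_naturality (CommRingCat.ofHom ev)) (Polynomial.X : Polynomial ℂ)
      refine this.symm.trans ?_
      rw [CommRingCat.comp_apply]
      simp [ev]
    have h2 : Spec.map (CommRingCat.ofHom ev) ≫
        Spec.map (CommRingCat.ofHom (Polynomial.C : ℂ →+* Polynomial ℂ)) = 𝟙 _ := by
      rw [← Spec.map_comp, ← CommRingCat.ofHom_comp, ← Spec.map_id]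
      congr 1
      ext c
      simp [ev]
    rw [h1, ← Category.assoc, h2, Category.id_comp, σ.zero_flow]
  have h3 := Scheme.ΓSpecIso_naturality (CommRingCat.ofHom ev)
  rw [CPoint.eval, ← h0, Scheme.Hom.comp_appTop, Category.assoc, h3]
  rfl

lemma GaAction.orbitPull_structure (c : Γ(SpecC, ⊤)) :
    σ.orbitPull p (π.appTop c) =
      Polynomial.C ((Scheme.ΓSpecIso (CommRingCat.of ℂ)).hom c) := by
  have h : σ.orbitMap p ≫ π =
      Spec.map (CommRingCat.ofHom (Polynomial.C : ℂ →+* Polynomial ℂ)) := by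
    rw [GaAction.orbitMap, σ.flow_over, Category.assoc, p.hom_over, Category.comp_id]
  have h1 : σ.orbitPull p (π.appTop c) =
      ((σ.orbitMap p ≫ π).appTop ≫
        (Scheme.ΓSpecIso (CommRingCat.of (Polynomial ℂ))).hom).hom c := by
    rw [Scheme.Hom.comp_appTop]
    rfl
  rw [h1, h, Scheme.ΓSpecIso_naturality]
  rfl

lemma GaAction.velocity_mem_tangentSpace [X.IsQuasiAffine] :
    σ.velocity p ∈ tangentSpace p := by
  refine ⟨fun f g => ?_, fun f g => ?_, fun c => ?_⟩
  · simp [σ.velocity_apply]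
  · simp only [σ.velocity_apply, map_mul, Polynomial.derivative_mul, Polynomial.eval_add,
      Polynomial.eval_mul, σ.eval_zero_orbitPull]
    ring
  · rw [σ.velocity_apply, σ.orbitPull_structure, Polynomial.derivative_C, Polynomial.eval_zero]

end Velocity

/-! ### Unipotent actions on `SL n` and flexibility -/

section SLFlexible

variable {n : ℕ} {T : Scheme.{0}}

/-- The matrix `1 + t N`. -/
def unip {R : Type*} [CommRing R] (N : Matrix (Fin n) (Fin n) ℤ) (t : R) :
    Matrix (Fin n) (Fin n) R :=
  1 + t • N.map (Int.cast : ℤ → R)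

lemma map_unip {R S : Type*} [CommRing R] [CommRing S] (φ : R →+* S)
    (N : Matrix (Fin n) (Fin n) ℤ) (t : R) : (unip N t).map φ = unip N (φ t) := by
  ext i j
  simp [unip, one_apply, apply_ite φ]

lemma unip_zero {R : Type*} [CommRing R] (N : Matrix (Fin n) (Fin n) ℤ) :
    unip N (0 : R) = 1 := by
  simp [unip]

lemma unip_add {R : Type*} [CommRing R] {N : Matrix (Fin n) (Fin n) ℤ} (hN : N * N = 0)
    (s t : R) : unip N (s + t) = unip N s * unip N t := by
  have h : N.map (Int.cast : ℤ → R) * N.map (Int.cast : ℤ → R) = 0 := by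
    have := congrArg (fun M => M.map (Int.castRingHom R)) hN
    rw [Matrix.map_mul] at this
    exact this.trans (Matrix.map_zero _ (map_zero _))
  simp only [unip, mul_add, add_mul, smul_mul_smul_comm, h, add_smul]
  simp
  abel

/-- Over ℤ[X] the matrix 1 + XN has inverse 1 - XN, so its determinant is a unit, hence constant,
and X = 0 gives 1. As `N` is integral, X can be specialized to any `t`. -/
lemma det_unip {R : Type*} [CommRing R] {N : Matrix (Fin n) (Fin n) ℤ} (hN : N * N = 0)
    (t : R) : (unip N t).det = 1 := by
  have hunit : IsUnit (unip N (Polynomial.X : Polynomial ℤ)).det := by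
    refine .of_mul_eq_one (unip N (-Polynomial.X : Polynomial ℤ)).det ?_
    rw [← det_mul, ← unip_add hN, add_neg_cancel, unip_zero, det_one]
  obtain ⟨r, -, hr⟩ := Polynomial.isUnit_iff.mp hunit
  have h0 := congrArg (Polynomial.evalRingHom 0) hr
  rw [RingHom.map_det, RingHom.mapMatrix_apply, map_unip] at h0
  simp only [Polynomial.coe_evalRingHom, Polynomial.eval_C, Polynomial.eval_X, unip_zero,
    det_one] at h0
  have h1 := congrArg (Polynomial.eval₂RingHom (Int.castRingHom R) t) hr
  rw [RingHom.map_det, RingHom.mapMatrix_apply, map_unip] at h1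
  simpa [h0] using h1.symm

/-- The action of `𝔾ₐ` on `SL n` by left multiplication with `1 + t N`, where `N * N = 0`. -/
def unipAct {N : Matrix (Fin n) (Fin n) ℤ} (hN : N * N = 0) : 𝔸(PUnit.{1}; SL n) ⟶ SL n :=
  ofMat ((𝔸(PUnit.{1}; SL n) ↘ SL n) ≫ SL.structureMap n)
    (unip N (AffineSpace.coord (SL n) PUnit.unit) * mat (𝔸(PUnit.{1}; SL n) ↘ SL n))
    (by rw [det_mul, det_unip hN, det_mat, one_mul])

lemma flow_unipAct_over {N : Matrix (Fin n) (Fin n) ℤ} (hN : N * N = 0) (t : Γ(T, ⊤))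
    (x : T ⟶ SL n) : flow (unipAct hN) t x ≫ SL.structureMap n = x ≫ SL.structureMap n := by
  rw [flow, unipAct, Category.assoc, ofMat_over, ← Category.assoc, AffineSpace.homOfVector_over]

lemma mat_flow_unipAct {N : Matrix (Fin n) (Fin n) ℤ} (hN : N * N = 0) (t : Γ(T, ⊤))
    (x : T ⟶ SL n) : mat (flow (unipAct hN) t x) = unip N t * mat x := by
  let h : T ⟶ 𝔸(PUnit.{1}; SL n) := AffineSpace.homOfVector x fun _ => t
  have h1 : h ≫ (𝔸(PUnit.{1}; SL n) ↘ SL n) = x := AffineSpace.homOfVector_over _ _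
  have h2 : h.appTop.hom (AffineSpace.coord (SL n) PUnit.unit) = t :=
    AffineSpace.homOfVector_appTop_coord _ _ _
  have h3 : mat x = (mat (𝔸(PUnit.{1}; SL n) ↘ SL n)).map h.appTop.hom := by
    rw [← mat_comp, h1]
  rw [flow, mat_comp, unipAct, mat_ofMat]
  refine (Matrix.map_mul (f := h.appTop.hom)).trans ?_
  rw [map_unip, h2, h3]

/-- The one-parameter unipotent group of left multiplications with `1 + t N`. -/
def unipAction {N : Matrix (Fin n) (Fin n) ℤ} (hN : N * N = 0) :
    GaAction (SL.structureMap n) where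
  act := unipAct hN
  act_over := ofMat_over _ _ _
  zero_flow T x := hom_ext_mat (flow_unipAct_over _ _ _)
    (by rw [mat_flow_unipAct, unip_zero, one_mul])
  add_flow T s t x := hom_ext_mat (by simp only [flow_unipAct_over])
    (by simp only [mat_flow_unipAct, unip_add hN, Matrix.mul_assoc])

/-- The matrix of a `ℂ`-point of `SL n`. -/
def CPoint.matrix (p : CPoint (SL.structureMap n)) : Matrix (Fin n) (Fin n) ℂ :=
  (mat (𝟙 (SL n))).map p.eval

lemma CPoint.det_matrix (p : CPoint (SL.structureMap n)) : p.matrix.det = 1 := by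
  rw [CPoint.matrix, ← RingHom.mapMatrix_apply, ← RingHom.map_det, det_mat, map_one]

lemma map_orbitPull_unipAction {N : Matrix (Fin n) (Fin n) ℤ} (hN : N * N = 0)
    (p : CPoint (SL.structureMap n)) :
    (mat (𝟙 (SL n))).map ((unipAction hN).orbitPull p) =
      unip N Polynomial.X * p.matrix.map Polynomial.C := by
  let e := Scheme.ΓSpecIso (CommRingCat.of (Polynomial ℂ))
  let i := Spec.map (CommRingCat.ofHom (Polynomial.C : ℂ →+* Polynomial ℂ))
  have h1 : (mat (𝟙 (SL n))).map ((unipAction hN).orbitPull p) =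
      (mat ((unipAction hN).orbitMap p)).map e.hom.hom := by
    have h := mat_comp ((unipAction hN).orbitMap p) (𝟙 (SL n))
    rw [Category.comp_id] at h
    rw [h, Matrix.map_map]
    rfl
  have h2 : mat ((unipAction hN).orbitMap p) =
      unip N (e.inv.hom Polynomial.X) * mat (i ≫ p.hom) := mat_flow_unipAct hN _ _
  have h3 : (mat (i ≫ p.hom)).map e.hom.hom = p.matrix.map Polynomial.C := by
    rw [← Category.comp_id p.hom, ← Category.assoc, mat_comp, Matrix.map_map, CPoint.matrix,
      Matrix.map_map]
    congr 1
    funext f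
    have := ConcreteCategory.congr_hom
      (Scheme.ΓSpecIso_naturality (CommRingCat.ofHom (Polynomial.C : ℂ →+* Polynomial ℂ)))
      (p.hom.appTop f)
    rw [Function.comp_apply, Scheme.Hom.comp_appTop]
    exact this
  have h4 : e.hom.hom (e.inv.hom Polynomial.X) = Polynomial.X := by simp
  rw [h1, h2, Matrix.map_mul, map_unip, h3, h4]

lemma velocity_unipAction {N : Matrix (Fin n) (Fin n) ℤ} (hN : N * N = 0)
    (p : CPoint (SL.structureMap n)) (a b : Fin n) :
    (unipAction hN).velocity p (mat (𝟙 (SL n)) a b) =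
      (N.map (Int.cast : ℤ → ℂ) * p.matrix) a b := by
  have h := congr_fun₂ (map_orbitPull_unipAction hN p) a b
  rw [map_apply] at h
  rw [GaAction.velocity_apply, h, unip, Matrix.add_mul, Matrix.one_mul, Matrix.smul_mul]
  have h2 : N.map (Int.cast : ℤ → Polynomial ℂ) * p.matrix.map Polynomial.C =
      (N.map (Int.cast : ℤ → ℂ) * p.matrix).map Polynomial.C := by
    rw [Matrix.map_mul, Matrix.map_map]
    congr 2
  rw [h2]
  simp only [Matrix.add_apply, Matrix.smul_apply, map_apply]
  simp

/-- A tangent vector of `SL n` is determined by its values on the matrix entries. -/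
lemma tangentSpace_ext {p : CPoint (SL.structureMap n)} {D E : Γ(SL n, ⊤) → ℂ}
    (hD : D ∈ tangentSpace p) (hE : E ∈ tangentSpace p)
    (h : ∀ a b, D (mat (𝟙 (SL n)) a b) = E (mat (𝟙 (SL n)) a b)) : D = E := by
  funext f
  let e := Scheme.ΓSpecIso (CommRingCat.of (SLRing n))
  have hpull : ∀ r : SLRing n, pull (𝟙 (SL n)) r = e.inv r := by
    intro r
    simp [pull, e]
  have hsurj : ∃ r : SLRing n, pull (𝟙 (SL n)) r = f := by
    refine ⟨e.hom f, ?_⟩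
    rw [hpull]
    simp
  obtain ⟨r, rfl⟩ := hsurj
  obtain ⟨P, rfl⟩ := Ideal.Quotient.mk_surjective r
  induction P using MvPolynomial.induction_on with
  | C c =>
    have hc : pull (𝟙 (SL n)) (Ideal.Quotient.mk _ (MvPolynomial.C c)) =
        (SL.structureMap n).appTop ((Scheme.ΓSpecIso (CommRingCat.of ℂ)).inv c) := by
      rw [hpull]
      exact ConcreteCategory.congr_hom (Scheme.ΓSpecIso_inv_naturality
        (CommRingCat.ofHom (algebraMap ℂ (SLRing n)))) c
    rw [hc, hD.2.2, hE.2.2]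
  | add P Q hP hQ => rw [map_add, map_add, hD.1, hE.1, hP, hQ]
  | mul_X P i hP =>
    have hi : D (pull (𝟙 (SL n)) (Ideal.Quotient.mk _ (MvPolynomial.X i))) =
        E (pull (𝟙 (SL n)) (Ideal.Quotient.mk _ (MvPolynomial.X i))) := h i.1 i.2
    rw [map_mul, map_mul, hD.2.1, hE.2.1, hP, hi]

/-- The ring homomorphism to the dual numbers given by a tangent vector. -/
def dualNumberHom {X : Scheme.{0}} [X.IsQuasiAffine] {π : X ⟶ SpecC} (p : CPoint π)
    {D : Γ(X, ⊤) → ℂ} (hD : D ∈ tangentSpace p) : Γ(X, ⊤) →+* DualNumber ℂ where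
  toFun f := TrivSqZeroExt.inl (p.eval f) + TrivSqZeroExt.inr (D f)
  map_one' := by
    have h := hD.2.1 1 1
    simp only [map_one, mul_one, one_mul] at h
    have h1 : D 1 = 0 := by linear_combination -h
    simp [h1]
  map_zero' := by
    have h := hD.1 0 0
    rw [add_zero] at h
    have h1 : D 0 = 0 := by linear_combination -h
    simp [h1]
  map_add' f g := by
    rw [hD.1, map_add, TrivSqZeroExt.inl_add, TrivSqZeroExt.inr_add]
    abel
  map_mul' f g := by
    ext
    · simp
    · simp [hD.2.1]
      ring

/-- The tangent vector is a dual-number point of `SL n`; its matrix (1 + εW) A has determinant 1,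
and so has A. -/
lemma trace_eq_zero_of_mem_tangentSpace {p : CPoint (SL.structureMap n)} {D : Γ(SL n, ⊤) → ℂ}
    (hD : D ∈ tangentSpace p) (W : Matrix (Fin n) (Fin n) ℂ)
    (hW : W * p.matrix = (mat (𝟙 (SL n))).map D) : W.trace = 0 := by
  apply trace_eq_zero_of_det_dualNumber
  have h1 : (mat (𝟙 (SL n))).map (dualNumberHom p hD) =
      (1 + (DualNumber.eps : DualNumber ℂ) • W.map (algebraMap ℂ (DualNumber ℂ))) *
        p.matrix.map (algebraMap ℂ (DualNumber ℂ)) := by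
    rw [Matrix.add_mul, Matrix.one_mul, Matrix.smul_mul, ← Matrix.map_mul, hW]
    ext a b
    · simp [dualNumberHom, CPoint.matrix, TrivSqZeroExt.algebraMap_eq_inl]
    · simp [dualNumberHom, CPoint.matrix, TrivSqZeroExt.algebraMap_eq_inl]
  have h2 := congrArg Matrix.det h1
  rw [det_mul, ← RingHom.mapMatrix_apply, ← RingHom.map_det, det_mat, map_one,
    ← RingHom.mapMatrix_apply _ p.matrix, ← RingHom.map_det, p.det_matrix, map_one, mul_one] at h2
  exact h2.symm

lemma isFlexible_SL (n : ℕ) : IsFlexible (SL.structureMap n) := by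
  intro p
  have hle : Submodule.span ℂ (Set.range fun σ : GaAction (SL.structureMap n) => σ.velocity p) ≤
      tangentSpace p := by
    rw [Submodule.span_le]
    rintro _ ⟨σ, rfl⟩
    exact σ.velocity_mem_tangentSpace p
  refine le_antisymm hle fun D hD => ?_
  -- Right translation by A⁻¹ carries the tangent vector to the identity.
  let W := (mat (𝟙 (SL n))).map D * p.matrix⁻¹
  have hW : W * p.matrix = (mat (𝟙 (SL n))).map D := by
    rw [Matrix.nonsing_inv_mul_cancel_right]
    rw [p.det_matrix]
    exact isUnit_one
  have hspan := mem_span_sq_zero_of_trace_eq_zero W (trace_eq_zero_of_mem_tangentSpace hD W hW)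
  -- The velocities realize N A for square-zero `N`; linearity extends this to their span, which
  -- contains `W`.
  have key : ∀ V ∈ Submodule.span ℂ
      {V | ∃ N : Matrix (Fin n) (Fin n) ℤ, N * N = 0 ∧ V = N.map (Int.cast : ℤ → ℂ)},
      ∃ E ∈ Submodule.span ℂ
        (Set.range fun σ : GaAction (SL.structureMap n) => σ.velocity p),
        ∀ a b, E (mat (𝟙 (SL n)) a b) = (V * p.matrix) a b := by
    intro V hV
    induction hV using Submodule.span_induction with
    | mem V h =>
      obtain ⟨N, hN, rfl⟩ := h
      exact ⟨_, Submodule.subset_span ⟨unipAction hN, rfl⟩, velocity_unipAction hN p⟩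
    | zero => exact ⟨0, zero_mem _, fun a b => by simp⟩
    | add V V' _ _ h h' =>
      obtain ⟨E, hE, h⟩ := h
      obtain ⟨E', hE', h'⟩ := h'
      refine ⟨E + E', add_mem hE hE', fun a b => ?_⟩
      rw [Matrix.add_mul, Pi.add_apply, h, h', Matrix.add_apply]
    | smul c V _ h =>
      obtain ⟨E, hE, h⟩ := h
      refine ⟨c • E, Submodule.smul_mem _ _ hE, fun a b => ?_⟩
      rw [Matrix.smul_mul, Pi.smul_apply, h, Matrix.smul_apply]
  obtain ⟨E, hE, hEW⟩ := key W hspan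
  have : D = E := tangentSpace_ext hD (hle hE) fun a b => by
    rw [hEW, hW, map_apply]
  rw [this]
  exact hE

end SLFlexible

end KFlex

end

theorem proposition5 (n : ℕ) (hn : 2 ≤ n) :
    KFlex.IsKFlexible (n ^ 2 - n) (KFlex.SL.structureMap n) where
  pos := by
    have : n * 2 ≤ n * n := Nat.mul_le_mul_left n hn
    rw [pow_two]
    omega
  manifold := KFlex.isQuasiAffineManifold_SL (by omega)
  flexible := KFlex.isFlexible_SL n
  exists_fibration := by
    obtain ⟨m, rfl⟩ : ∃ m, n = m + 1 := ⟨n - 1, by omega⟩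
    exact ⟨_, _, KFlex.minorMap m, KFlex.minorTorus m, KFlex.isNormalAffineVariety_mvPolynomial,
      KFlex.minorMap_over m, KFlex.dense_minorTorus m, KFlex.isTrivialOver_minorMap m⟩
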